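/- Let $T$ be a subdivision of a star, i.e. a graph consisting of a root and $d$ legs, where the $j$th leg is a path of some length $\ell_j\ge 1$ starting at the root, and the legs share no vertex other than the root. Then there is a constant $C$, depending only on $T$, such that for every $n$ there is a quantum query algorithm that, given query access to the adjacency matrix of a simple graph $G$ on $n$ vertices, makes at most $Cn$ queries (so $O(n)$ queries) and satisfies, for every such $G$: * if $G$ contains $T$ as a (not necessarily induced) subgraph, then the algorithm accepts with probability at least $2/3$; * if $G$ does not contain $T$ as a minor, then the algorithm rejects with probability at least $2/3$. Here $T$ is a minor of $G$ if there are pairwise disjoint sets of vertices of $G$, one for each vertex of $T$, each inducing a connected subgraph of $G$, such that $G$ has an edge between the sets of any two adjacent vertices of $T$. A quantum query algorithm with $q$ queries applies $U_q O_G U_{q-1} \cdots O_G U_0$ to a fixed basis state of a finite-dimensional Hilbert space, where the unitaries $U_k$ do not depend on $G$ and $O_G|i,j,b,w\rangle = |i,j,b\oplus x_{ij},w\rangle$ for the adjacency matrix $(x_{ij})$ of $G$ (the query register may also hold an idle value on which $O_G$ is the identity), and accepts or rejects according to a measurement in the computational basis. -/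

import Mathlib

open scoped Matrix

/-! ### Graphs -/

/-- Generating relation of the subdivided star: the root `none` is joined to the first vertex of every
leg, and consecutive vertices of one leg are joined. The vertex `some ⟨j, i⟩` is the one
at distance `i + 1` from the root on leg `j`. -/
def legRel {d : ℕ} (l : Fin d → ℕ) :
    Option (Σ j : Fin d, Fin (l j)) → Option (Σ j : Fin d, Fin (l j)) → Prop
  | none, some a => a.2.val = 0
  | some a, some b => a.1 = b.1 ∧ b.2.val = a.2.val + 1
  | _, none => False

/-- The star with `d` legs in which the `j`-th edge is replaced by a path with `l j` edges. -/
def subdividedStar {d : ℕ} (l : Fin d → ℕ) : SimpleGraph (Option (Σ j : Fin d, Fin (l j))) :=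
  SimpleGraph.fromRel (legRel l)

/-- `T` is a subdivision of a star `K_{1,d}`: each edge of the star becomes a path of positive
length. -/
def IsSubdividedStar {V : Type*} (T : SimpleGraph V) : Prop :=
  ∃ (d : ℕ) (l : Fin d → ℕ), (∀ j, 0 < l j) ∧ Nonempty (T ≃g subdividedStar l)

/-- `T` is a minor of `G`: there are connected (hence nonempty), pairwise disjoint branch sets
in `G`, one for each vertex of `T`, with an edge of `G` between the branch sets of any two
adjacent vertices of `T`. -/
def IsGraphMinor {V W : Type*} (T : SimpleGraph V) (G : SimpleGraph W) : Prop :=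
  ∃ B : V → Set W, (∀ v, (G.induce (B v)).Connected) ∧
    (∀ u v, u ≠ v → Disjoint (B u) (B v)) ∧
    ∀ u v, T.Adj u v → ∃ a ∈ B u, ∃ b ∈ B v, G.Adj a b

/-! ### Quantum query algorithms -/

/-- The computational basis of a quantum query algorithm for inputs `x : ι → Bool`: a query
register (a position in `ι`, or `none` for "no position"), an answer bit, and a workspace. -/
abbrev QueryBasis (ι work : Type) : Type := Option ι × Bool × work

/-- A quantum query algorithm for inputs `x : ι → Bool`: a finite workspace, a starting basis
state, a number of queries, a sequence of input-independent unitaries (those with index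
`0, …, queries` are applied), and the output bit read off from a
measurement in the computational basis. -/
structure QueryAlgorithm (ι : Type) [Fintype ι] [DecidableEq ι] where
  work : Type
  [fintypeWork : Fintype work]
  [decEqWork : DecidableEq work]
  start : QueryBasis ι work
  queries : ℕ
  U : ℕ → Matrix.unitaryGroup (QueryBasis ι work) ℂ
  output : QueryBasis ι work → Bool

attribute [instance] QueryAlgorithm.fintypeWork QueryAlgorithm.decEqWork

/-- The answer to a query: the bit `x i` at position `i`, and `false` at no position. -/
def queryAnswer {ι : Type} (x : ι → Bool) : Option ι → Bool
  | none => false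
  | some i => x i

/-- One query: the linear map with `|i, b, w⟩ ↦ |i, b ⊕ xᵢ, w⟩`. This permutation of the basis is
an involution, so the amplitude of the image at `(i, b, w)` is that of `ψ` at
`(i, b ⊕ xᵢ, w)`. -/
def applyOracle {ι work : Type} (x : ι → Bool) (ψ : QueryBasis ι work → ℂ) :
    QueryBasis ι work → ℂ :=
  fun p => ψ (p.1, xor p.2.1 (queryAnswer x p.1), p.2.2)

namespace QueryAlgorithm

variable {ι : Type} [Fintype ι] [DecidableEq ι]

/-- The state `U k · O_x · U (k-1) ⋯ O_x · U 0 |start⟩` after `k` queries. -/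
def state (A : QueryAlgorithm ι) (x : ι → Bool) : ℕ → QueryBasis ι A.work → ℂ
  | 0 => (A.U 0).val *ᵥ Pi.single A.start 1
  | k + 1 => (A.U (k + 1)).val *ᵥ applyOracle x (A.state x k)

/-- The probability that the algorithm outputs `b` on input `x`: the final state is measured in
the computational basis. -/
noncomputable def outputProb (A : QueryAlgorithm ι) (x : ι → Bool) (b : Bool) : ℝ :=
  ∑ p with A.output p = b, ‖A.state x A.queries p‖ ^ 2

/-- The probability of acceptance. -/
noncomputable def acceptProb (A : QueryAlgorithm ι) (x : ι → Bool) : ℝ := A.outputProb x true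

/-- The probability of rejection. -/
noncomputable def rejectProb (A : QueryAlgorithm ι) (x : ι → Bool) : ℝ := A.outputProb x false

end QueryAlgorithm

open Classical in
/-- The adjacency matrix of `G` as an input: the bit at position `(i, j)` tells whether `i` and `j`
are adjacent. -/
noncomputable def adjInput {n : ℕ} (G : SimpleGraph (Fin n)) : Fin n × Fin n → Bool :=
  fun p => decide (G.Adj p.1 p.2)

/-! ### Extending isometries to unitaries -/

/-! The algorithm evaluates a span program that runs over all colourings of the vertices of `G` by
the vertices of the star at once. Test vectors are differences of potentials, one potential per leg
and colouring, that vanish at leaf colours and add up to a common value at every root-coloured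
vertex. Only pairs coloured by an edge of the star carry an entry.

If `G` contains a copy of the star, a flow through the copy, spread evenly over the colourings that
are correct on it, is orthogonal to all tests (`inner_copyFlow_eq_zero`). A fraction of colourings
independent of `n` is correct (`card_colourings_le`), so this flow has small norm. If `G` has no
such minor, every colouring admits a cut: each root-coloured vertex selects one leg, consistently
along coloured edges of `G`, and no selection reaches a leaf (`exists_leg_choice`). Otherwise one
component would have access to the leaves of all legs, which yields the minor
(`isGraphMinor_of_reachesLeaf`). The indicator of the cut is a potential whose differences vanish on
edges of `G` (`exists_dropVector_of_not_minor`). Per colouring it has at most `n ^ 2` nonzero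
entries, hence a norm of order `n` after scaling.

`exists_queryAlgorithm_of_tests` turns these witnesses into an algorithm. A product of two
reflections is iterated and its orbit averaged: a fixed vector keeps the average large
(`inner_walkAverage_of_fixed`), while a telescoping sum makes it small (`norm_walkAverage_le`). Each
step costs one query, and order `n` steps suffice. -/

theorem exists_isometry_extending {E H : Type*} [NormedAddCommGroup E] [InnerProductSpace ℂ E]
    [NormedAddCommGroup H] [InnerProductSpace ℂ H] [FiniteDimensional ℂ H]
    (J J' : E →ₗᵢ[ℂ] H) : ∃ W : H ≃ₗᵢ[ℂ] H, ∀ v, W (J v) = J' v := by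
  let M : J.range →ₗᵢ[ℂ] H := J'.comp J.equivRange.symm.toLinearIsometry
  refine ⟨M.extend.toLinearIsometryEquiv rfl, fun v => ?_⟩
  have h := M.extend_apply (J.equivRange v)
  have h2 : M (J.equivRange v) = J' v := by simp [M]
  rw [h2] at h
  simpa using h

theorem exists_unitary_mulVec {κ : Type*} [Fintype κ] [DecidableEq κ]
    (W : EuclideanSpace ℂ κ ≃ₗᵢ[ℂ] EuclideanSpace ℂ κ) :
    ∃ U : Matrix.unitaryGroup κ ℂ, ∀ v : EuclideanSpace ℂ κ, U.val *ᵥ v.ofLp = (W v).ofLp := by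
  let T := Unitary.linearIsometryEquiv.symm W
  let A := (Matrix.toEuclideanCLM (n := κ) (𝕜 := ℂ)).symm T.val
  refine ⟨⟨A, ?_⟩, fun v => ?_⟩
  · exact Unitary.map_mem (Matrix.toEuclideanCLM (n := κ) (𝕜 := ℂ)).symm T.2
  · have h := Matrix.toEuclideanCLM_toLp (𝕜 := ℂ) A v.ofLp
    have h2 : Matrix.toEuclideanCLM (n := κ) (𝕜 := ℂ) A = T.val := by simp [A]
    rw [h2] at h
    have h3 : T.val v = W v := by simp [T]
    have h4 := congrArg WithLp.ofLp h
    simp only at h4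
    rw [← h4]
    exact congrArg WithLp.ofLp h3

/-- A run visits only states in the range of an embedding, so a gate need only be prescribed there;
finite dimension supplies the extension to a unitary. -/
theorem exists_unitary_extending {κ E : Type*} [Fintype κ] [DecidableEq κ] [NormedAddCommGroup E]
    [InnerProductSpace ℂ E] (J J' : E →ₗᵢ[ℂ] EuclideanSpace ℂ κ) :
    ∃ U : Matrix.unitaryGroup κ ℂ, ∀ v, U.val *ᵥ (J v).ofLp = (J' v).ofLp := by
  obtain ⟨W, hW⟩ := exists_isometry_extending J J'
  obtain ⟨U, hU⟩ := exists_unitary_mulVec W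
  exact ⟨U, fun v => by rw [hU, hW]⟩

/-! ### Phase queries -/

section Phase

variable {ι I : Type} {N : ℕ}

/-- States of an algorithm that consists of a clock with `N` values and a register `I`. -/
abbrev ClockState (N : ℕ) (I : Type) : Type := PiLp 2 fun _ : Fin N => EuclideanSpace ℂ I

/-- Negation of the coordinates marked by `s`. -/
noncomputable def signFlip [Fintype I] (s : I → Bool) : EuclideanSpace ℂ I ≃ₗᵢ[ℂ] EuclideanSpace ℂ I :=
  LinearIsometryEquiv.piLpCongrRight 2 fun i =>
    if s i then LinearIsometryEquiv.neg ℂ else LinearIsometryEquiv.refl ℂ ℂ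

theorem signFlip_apply [Fintype I] (s : I → Bool) (f : EuclideanSpace ℂ I) (i : I) :
    signFlip s f i = if s i then -f i else f i := by
  simp only [signFlip, LinearIsometryEquiv.piLpCongrRight_apply]
  split_ifs <;> simp

/-- Application of one isometry to each clock value. -/
noncomputable def slicewise [Fintype I] (W : Fin N → EuclideanSpace ℂ I ≃ₗᵢ[ℂ] EuclideanSpace ℂ I) :
    ClockState N I ≃ₗᵢ[ℂ] ClockState N I :=
  LinearIsometryEquiv.piLpCongrRight 2 W

@[simp]
theorem slicewise_apply [Fintype I] (W : Fin N → EuclideanSpace ℂ I ≃ₗᵢ[ℂ] EuclideanSpace ℂ I)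
    (f : ClockState N I) (τ : Fin N) : slicewise W f τ = W τ (f τ) := by
  simp [slicewise]

variable [DecidableEq ι]

/-- Amplitude of the query register and the answer bit, when the former holds the
label of the current position and the latter is in the state `(|0⟩ - |1⟩) / √2`. -/
noncomputable def kickbackAmplitude (o : Option ι) (p : Option ι) (b : Bool) : ℂ :=
  if p = o then (if b then -1 else 1) / (√2 : ℝ) else 0

theorem sum_norm_kickbackAmplitude [Fintype ι] (o : Option ι) :
    ∑ p : Option ι, ∑ b : Bool, ‖kickbackAmplitude o p b‖ ^ 2 = 1 := by
  rw [Finset.sum_eq_single o]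
  · simp [kickbackAmplitude]
    norm_num
  · intro p _ hp
    simp [kickbackAmplitude, hp]
  · simp

/-- Flipping the bit negates `(|0⟩ - |1⟩) / √2`, so the answer becomes a sign. The amplitude lives
on `p = o`, hence the answer may be read at `o`. -/
theorem kickbackAmplitude_xor (x : ι → Bool) (o p : Option ι) (b : Bool) :
    kickbackAmplitude o p (xor b (queryAnswer x p)) =
      (if queryAnswer x o then -1 else 1) * kickbackAmplitude o p b := by
  unfold kickbackAmplitude
  by_cases h : p = o
  · subst h
    cases b <;> cases queryAnswer x p <;> simp [neg_div]
  · simp [h]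

/-- The basis amplitudes of a clock state whose query register is prepared for phase kickback. -/
noncomputable def kickback (pos : I → Option ι) (f : ClockState N I) :
    QueryBasis ι (Fin N × I) → ℂ :=
  fun p => kickbackAmplitude (pos p.2.2.2) p.1 p.2.1 * f p.2.2.1 p.2.2.2

theorem applyOracle_kickback [Fintype I] (x : ι → Bool) (pos : I → Option ι) (f : ClockState N I) :
    applyOracle x (kickback pos f) =
      kickback pos (slicewise (fun _ => signFlip fun i => queryAnswer x (pos i)) f) := by
  funext p
  simp only [applyOracle, kickback, slicewise_apply, signFlip_apply, kickbackAmplitude_xor]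
  split_ifs <;> ring

variable [Fintype ι] [Fintype I]

theorem sum_norm_kickback (pos : I → Option ι) (f : ClockState N I) (P : Fin N → Prop)
    [DecidablePred P] :
    ∑ p : QueryBasis ι (Fin N × I) with P p.2.2.1, ‖kickback pos f p‖ ^ 2 =
      ∑ τ with P τ, ‖f τ‖ ^ 2 := by
  rw [Finset.sum_filter, Finset.sum_filter]
  simp only [Fintype.sum_prod_type]
  have hsw : ∀ F : Option ι → Bool → Fin N → I → ℝ,
      ∑ p, ∑ b, ∑ τ, ∑ i, F p b τ i = ∑ τ, ∑ i, ∑ p, ∑ b, F p b τ i := by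
    intro F
    simp_rw [Finset.sum_comm (s := (Finset.univ : Finset Bool)) (t := (Finset.univ : Finset (Fin N)))]
    rw [Finset.sum_comm]
    refine Finset.sum_congr rfl fun τ _ => ?_
    simp_rw [Finset.sum_comm (s := (Finset.univ : Finset Bool)) (t := (Finset.univ : Finset I))]
    rw [Finset.sum_comm]
  rw [hsw]
  refine Finset.sum_congr rfl fun τ _ => ?_
  split_ifs with h
  · rw [EuclideanSpace.norm_sq_eq]
    refine Finset.sum_congr rfl fun i _ => ?_
    simp only [kickback, norm_mul, mul_pow]
    simp_rw [← Finset.sum_mul]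
    rw [sum_norm_kickbackAmplitude, one_mul]
  · simp

/-- `kickback` as an isometry. -/
noncomputable def kickbackIsometry (pos : I → Option ι) :
    ClockState N I →ₗᵢ[ℂ] EuclideanSpace ℂ (QueryBasis ι (Fin N × I)) where
  toFun f := WithLp.toLp 2 (kickback pos f)
  map_add' f g := by
    ext p
    simp [kickback, mul_add]
  map_smul' c f := by
    ext p
    simp [kickback]
    ring
  norm_map' f := by
    rw [← sq_eq_sq₀ (norm_nonneg _) (norm_nonneg _), EuclideanSpace.norm_sq_eq,
      PiLp.norm_sq_eq_of_L2]
    simpa using sum_norm_kickback pos f (fun _ => True)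

/-- An algorithm given by arbitrary isometries of a clock and a register, alternating with
queries of the phase of the label of the register. -/
theorem exists_queryAlgorithm_of_clock [DecidableEq I] (pos : I → Option ι) (f₀ : ClockState N I)
    (hf₀ : ‖f₀‖ = 1) (q : ℕ) (W : ℕ → ClockState N I ≃ₗᵢ[ℂ] ClockState N I) (τ₀ : Fin N) (i₀ : I) :
    ∃ A : QueryAlgorithm ι, A.queries = q ∧ ∀ x : ι → Bool, ∀ f : ℕ → ClockState N I,
      f 0 = f₀ →
      (∀ k, f (k + 1) = W k (slicewise (fun _ => signFlip fun i => queryAnswer x (pos i)) (f k))) →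
      A.acceptProb x = ‖f q τ₀‖ ^ 2 ∧ A.rejectProb x = 1 - ‖f q τ₀‖ ^ 2 := by
  let start : QueryBasis ι (Fin N × I) := (none, false, τ₀, i₀)
  let S : ℂ →ₗᵢ[ℂ] EuclideanSpace ℂ (QueryBasis ι (Fin N × I)) :=
    LinearIsometry.toSpanSingleton ℂ _ (v := EuclideanSpace.single start (1 : ℂ)) (by simp)
  let S' : ℂ →ₗᵢ[ℂ] EuclideanSpace ℂ (QueryBasis ι (Fin N × I)) :=
    LinearIsometry.toSpanSingleton ℂ _ (v := kickbackIsometry pos f₀) (by simp [hf₀])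
  obtain ⟨U₀, hU₀⟩ := exists_unitary_extending S S'
  have hU := fun k => exists_unitary_extending (kickbackIsometry (N := N) pos)
    ((kickbackIsometry pos).comp (W k).toLinearIsometry)
  choose U hU using hU
  let A : QueryAlgorithm ι :=
    { work := Fin N × I
      start := start
      queries := q
      U := fun k => Nat.casesOn k U₀ U
      output := fun p => decide (p.2.2.1 = τ₀) }
  refine ⟨A, rfl, fun x f h0 hs => ?_⟩
  have hstate : ∀ k, A.state x k = kickback pos (f k) := by
    intro k
    induction k with
    | zero =>
      have h := hU₀ 1
      simp only [S, S', LinearIsometry.toSpanSingleton_apply, one_smul] at h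
      rw [h0]
      exact h
    | succ k ih =>
      have h := hU k (slicewise (fun _ => signFlip fun i => queryAnswer x (pos i)) (f k))
      rw [hs]
      change (U k).val *ᵥ applyOracle x (A.state x k) = _
      rw [ih, applyOracle_kickback]
      exact h
  have hnorm : ∀ k, ‖f k‖ = 1 := by
    intro k
    induction k with
    | zero => rw [h0, hf₀]
    | succ k ih => rw [hs, LinearIsometryEquiv.norm_map, LinearIsometryEquiv.norm_map, ih]
  have hacc : A.acceptProb x = ‖f q τ₀‖ ^ 2 := by
    have h := sum_norm_kickback pos (f q) (fun τ => τ = τ₀)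
    rw [Finset.sum_filter (p := fun τ => τ = τ₀), Finset.sum_ite_eq' , if_pos (Finset.mem_univ _)] at h
    rw [← h]
    unfold QueryAlgorithm.acceptProb QueryAlgorithm.outputProb
    change ∑ p with A.output p = true, ‖A.state x q p‖ ^ 2 = _
    rw [hstate]
    simp only [A, decide_eq_true_eq]
  have hrej : A.rejectProb x = ∑ τ with ¬ τ = τ₀, ‖f q τ‖ ^ 2 := by
    rw [← sum_norm_kickback pos (f q) (fun τ => ¬ τ = τ₀)]
    unfold QueryAlgorithm.rejectProb QueryAlgorithm.outputProb
    change ∑ p with A.output p = false, ‖A.state x q p‖ ^ 2 = _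
    rw [hstate]
    simp only [A, decide_eq_false_iff_not]
  refine ⟨hacc, ?_⟩
  have h1 := PiLp.norm_sq_eq_of_L2 _ (f q)
  rw [hnorm, ← Finset.sum_filter_add_sum_filter_not Finset.univ (fun τ => τ = τ₀) , ← hrej,
    Finset.sum_filter (p := fun τ => τ = τ₀), Finset.sum_ite_eq', if_pos (Finset.mem_univ _)] at h1
  linarith

end Phase

/-! ### Averaged products of two reflections -/

section Walk

variable {ι I : Type} [Fintype I]

/-- The reflection that fixes the available positions and negates the others. -/
noncomputable def availReflection (pos : I → Option ι) (x : ι → Bool) :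
    EuclideanSpace ℂ I ≃ₗᵢ[ℂ] EuclideanSpace ℂ I :=
  (signFlip fun i => queryAnswer x (pos i)).trans (signFlip fun i => (pos i).isSome)

theorem availReflection_apply (pos : I → Option ι) (x : ι → Bool) (f : EuclideanSpace ℂ I) (i : I) :
    availReflection pos x f i = if ∃ a, pos i = some a ∧ x a = false then -f i else f i := by
  simp only [availReflection, LinearIsometryEquiv.trans_apply, signFlip_apply]
  rcases h : pos i with _ | a
  · simp [queryAnswer]
  · cases hx : x a <;> simp [queryAnswer, hx]

/-- One step of the walk: the reflection in `K` followed by the reflection in the space of available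
positions. -/
noncomputable def walkStep (pos : I → Option ι) (K : Submodule ℂ (EuclideanSpace ℂ I))
    (x : ι → Bool) : EuclideanSpace ℂ I ≃ₗᵢ[ℂ] EuclideanSpace ℂ I :=
  K.reflection.trans (availReflection pos x)

/-- The average of the first `N` states of the walk started at `e`. -/
noncomputable def walkAverage (pos : I → Option ι) (K : Submodule ℂ (EuclideanSpace ℂ I))
    (x : ι → Bool) (N : ℕ) (e : EuclideanSpace ℂ I) : EuclideanSpace ℂ I :=
  (N : ℂ)⁻¹ • ∑ τ : Fin N, (walkStep pos K x)^[τ] e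

/-- The embedding of the register states with a uniform clock. -/
noncomputable def uniformClock (N : ℕ) (hN : 0 < N) :
    EuclideanSpace ℂ I →ₗᵢ[ℂ] ClockState N I where
  toFun g := WithLp.toLp 2 fun _ => ((√N : ℝ) : ℂ)⁻¹ • g
  map_add' f g := by ext; simp
  map_smul' c f := by ext; simp; ring
  norm_map' f := by
    rw [← sq_eq_sq₀ (norm_nonneg _) (norm_nonneg _), PiLp.norm_sq_eq_of_L2]
    have : (0 : ℝ) < N := by exact_mod_cast hN
    simp [norm_smul, mul_pow]
    field_simp

/-- The embedding of the register states with a fixed clock. -/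
noncomputable def fixedClock {N : ℕ} (τ₀ : Fin N) : EuclideanSpace ℂ I →ₗᵢ[ℂ] ClockState N I where
  toFun g := WithLp.toLp 2 (Pi.single τ₀ g)
  map_add' f g := by
    rw [Pi.single_add]; rfl
  map_smul' c f := by
    rw [Pi.single_smul]; rfl
  norm_map' f := by
    rw [← sq_eq_sq₀ (norm_nonneg _) (norm_nonneg _), PiLp.norm_sq_eq_of_L2,
      Finset.sum_eq_single τ₀]
    · simp
    · intro τ _ hτ
      simp [hτ]
    · simp

/-- A rotation of the clock that turns the uniform state into a basis state: it collects
the average of the slices in one slice. -/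
theorem exists_clock_average {N : ℕ} (hN : 0 < N) (τ₀ : Fin N) :
    ∃ W : ClockState N I ≃ₗᵢ[ℂ] ClockState N I, ∀ f : ClockState N I,
      W f τ₀ = ((√N : ℝ) : ℂ)⁻¹ • ∑ τ, f τ := by
  obtain ⟨W, hW⟩ := exists_isometry_extending (uniformClock (I := I) N hN) (fixedClock τ₀)
  refine ⟨W, fun f => ?_⟩
  -- Since `W` carries the uniform embedding to the fixed one, the slice of `W f` at `τ₀` is the
  -- adjoint of the uniform embedding applied to `f`.
  refine ext_inner_left ℂ fun v => ?_
  have h : inner ℂ (fixedClock τ₀ v) (W f) = inner ℂ (uniformClock N hN v) f := by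
    rw [← hW, LinearIsometryEquiv.inner_map_map]
  rw [PiLp.inner_apply, PiLp.inner_apply, Finset.sum_eq_single τ₀] at h
  · simp only [fixedClock, uniformClock] at h
    simp [inner_smul_left, ← Finset.mul_sum, ← inner_sum] at h
    rw [h, inner_smul_right]
  · intro τ _ hτ
    simp [fixedClock, hτ]
  · simp

/-- All powers of the walk are computed in superposition over the clock, and the clock rotation then
gathers their average in one slice, whose weight is the acceptance probability. -/
theorem exists_walkAverage_algorithm [Fintype ι] [DecidableEq ι] [DecidableEq I]
    (pos : I → Option ι) (K : Submodule ℂ (EuclideanSpace ℂ I)) (s : I) (hs : pos s = none)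
    (N : ℕ) (hN : 0 < N) :
    ∃ A : QueryAlgorithm ι, A.queries = N ∧ ∀ x : ι → Bool,
      A.acceptProb x = ‖walkAverage pos K x N (EuclideanSpace.single s 1)‖ ^ 2 ∧
      A.rejectProb x = 1 - ‖walkAverage pos K x N (EuclideanSpace.single s 1)‖ ^ 2 := by
  let e : EuclideanSpace ℂ I := EuclideanSpace.single s 1
  let τ₀ : Fin N := ⟨0, hN⟩
  obtain ⟨V, hV⟩ := exists_clock_average (I := I) hN τ₀
  -- Slice `τ` waits for `N - τ` rounds and walks in the remaining `τ` rounds. While it waits, the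
  -- query still acts, but it fixes `e` because `s` carries no query.
  let C : ℕ → ClockState N I ≃ₗᵢ[ℂ] ClockState N I := fun k =>
    slicewise fun τ => if N ≤ τ + k then K.reflection else LinearIsometryEquiv.refl ℂ _
  let F : ClockState N I ≃ₗᵢ[ℂ] ClockState N I :=
    slicewise fun _ => signFlip fun i => (pos i).isSome
  -- The gate between two queries completes one availability reflection and starts the next round;
  -- after the last query it rotates the clock instead.
  let W : ℕ → ClockState N I ≃ₗᵢ[ℂ] ClockState N I := fun k =>
    F.trans (if k + 1 < N then C (k + 1) else V)
  obtain ⟨A, hA, hAx⟩ := exists_queryAlgorithm_of_clock pos (uniformClock N hN e)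
    (by rw [LinearIsometry.norm_map]; simp [e]) N W τ₀ s
  refine ⟨A, hA, fun x => ?_⟩
  let a : ℕ → ClockState N I := fun k =>
    WithLp.toLp 2 fun τ => ((√N : ℝ) : ℂ)⁻¹ • (walkStep pos K x)^[τ + k - N] e
  let D : ClockState N I ≃ₗᵢ[ℂ] ClockState N I :=
    slicewise fun _ => signFlip fun i => queryAnswer x (pos i)
  have hR : availReflection pos x e = e := by
    ext i
    rw [availReflection_apply]
    by_cases hi : i = s
    · subst hi; simp [hs]
    · simp [e, hi]
  have hstep : ∀ k, F (D (C k (a k))) = a (k + 1) := by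
    intro k
    refine PiLp.ext fun τ => ?_
    simp only [F, D, C, slicewise_apply, a]
    change availReflection pos x _ = _
    by_cases h : N ≤ τ + k
    · rw [if_pos h, show (τ : ℕ) + (k + 1) - N = (τ + k - N) + 1 by omega,
        Function.iterate_succ_apply', map_smul, map_smul]
      rfl
    · rw [if_neg h, show (τ : ℕ) + (k + 1) - N = 0 by omega, show (τ : ℕ) + k - N = 0 by omega]
      simp [hR]
  let f : ℕ → ClockState N I := fun k => Nat.rec (uniformClock N hN e) (fun k g => W k (D g)) k
  have hf : ∀ k, k < N → f k = C k (a k) := by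
    intro k
    induction k with
    | zero =>
      intro _
      refine PiLp.ext fun τ => ?_
      have h1 : ¬ N ≤ (τ : ℕ) := by omega
      simp [C, h1, a, f, uniformClock]
    | succ k ih =>
      intro hk
      change W k (D (f k)) = _
      simp only [W, if_pos hk, LinearIsometryEquiv.trans_apply]
      rw [ih (by omega), hstep]
  have hlast : f N = V (a N) := by
    obtain ⟨M, rfl⟩ : ∃ M, N = M + 1 := ⟨N - 1, by omega⟩
    change W M (D (f M)) = _
    simp only [W, lt_irrefl, if_false, LinearIsometryEquiv.trans_apply]
    rw [hf M (by omega), hstep]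
  have hfin : f N τ₀ = walkAverage pos K x N e := by
    rw [hlast, hV, walkAverage]
    simp only [a, Nat.add_sub_cancel]
    rw [← Finset.smul_sum, smul_smul]
    congr 1
    rw [← mul_inv, ← Complex.ofReal_mul, Real.mul_self_sqrt (by positivity)]
    simp
  have h := hAx x f rfl (fun k => rfl)
  rwa [hfin] at h

/-- A unitary that fixes `ψ` preserves inner products with `ψ`, so the whole orbit of `e` has the
same component along it. -/
theorem inner_walkAverage_of_fixed (pos : I → Option ι) (K : Submodule ℂ (EuclideanSpace ℂ I))
    (x : ι → Bool) (N : ℕ) (hN : 0 < N) (e ψ : EuclideanSpace ℂ I) (hψ : walkStep pos K x ψ = ψ) :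
    inner ℂ ψ (walkAverage pos K x N e) = inner ℂ ψ e := by
  have h : ∀ m : ℕ, inner ℂ ψ ((walkStep pos K x)^[m] e) = inner ℂ ψ e := by
    intro m
    induction m with
    | zero => rfl
    | succ m ih =>
      rw [Function.iterate_succ_apply', ← ih]
      conv_lhs => rw [← hψ]
      rw [LinearIsometryEquiv.inner_map_map]
  rw [walkAverage, inner_smul_right, inner_sum]
  simp only [h]
  have : (N : ℂ) ≠ 0 := by exact_mod_cast hN.ne'
  simp
  field_simp

/-- The hypothesis makes `e` half of `u - U u`, so the sum over the orbit telescopes to two terms of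
norm `‖u‖`. -/
theorem norm_walkAverage_le (pos : I → Option ι) (K : Submodule ℂ (EuclideanSpace ℂ I))
    (x : ι → Bool) (N : ℕ) (e u : EuclideanSpace ℂ I)
    (hu : walkStep pos K x u = u - (2 : ℂ) • e) :
    ‖walkAverage pos K x N e‖ ≤ ‖u‖ / N := by
  set U := walkStep pos K x with hU
  have he : e = (2 : ℂ)⁻¹ • (u - U u) := by rw [hu]; simp
  have hpow : ∀ m : ℕ, U^[m] e = (2 : ℂ)⁻¹ • (U^[m] u - U^[m + 1] u) := by
    intro m
    induction m with
    | zero => exact he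
    | succ m ih =>
      rw [Function.iterate_succ_apply', ih, map_smul, map_sub, ← Function.iterate_succ_apply' U,
        ← Function.iterate_succ_apply' U]
  have hsum : ∑ τ : Fin N, U^[τ] e = (2 : ℂ)⁻¹ • (u - U^[N] u) := by
    rw [Fin.sum_univ_eq_sum_range (fun m => U^[m] e)]
    simp only [hpow]
    rw [← Finset.smul_sum, Finset.sum_range_sub' (fun m => U^[m] u)]
    rfl
  have hn : ‖U^[N] u‖ = ‖u‖ := by
    clear hsum
    induction N with
    | zero => rfl
    | succ N ih => rw [Function.iterate_succ_apply', LinearIsometryEquiv.norm_map, ih]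
  rw [walkAverage, ← hU, hsum, norm_smul, norm_smul]
  have h := norm_sub_le u (U^[N] u)
  rw [hn] at h
  simp only [norm_inv, RCLike.norm_natCast, RCLike.norm_ofNat]
  rw [div_eq_inv_mul]
  gcongr
  linarith

end Walk

/-! ### Span programs -/

/-- An algorithm from test vectors `S`. An input is accepted if a vector of small norm that is
orthogonal to `S` is supported on the available positions and has the entry `1` at `s`. It is
rejected if some test vector of bounded norm has its entry at `s`, which is `1`, as the only nonzero
entry at an available position. -/
theorem exists_queryAlgorithm_of_tests {ι I : Type} [Fintype ι] [DecidableEq ι] [Fintype I]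
    [DecidableEq I] (pos : I → Option ι) (s : I) (hs : pos s = none) (S : Set (EuclideanSpace ℂ I))
    (N : ℕ) (hN : 0 < N) :
    ∃ A : QueryAlgorithm ι, A.queries = N ∧ ∀ x : ι → Bool,
      ((∃ ψ : EuclideanSpace ℂ I, (∀ y ∈ S, inner ℂ y ψ = 0) ∧ ψ s = 1 ∧ ‖ψ‖ ^ 2 ≤ 3 / 2 ∧
        ∀ i a, pos i = some a → x a = false → ψ i = 0) → 2 / 3 ≤ A.acceptProb x) ∧
      ((∃ u ∈ S, u s = 1 ∧ 3 * ‖u‖ ^ 2 ≤ N ^ 2 ∧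
        ∀ i, i ≠ s → (∀ a, pos i = some a → x a = true) → u i = 0) → 2 / 3 ≤ A.rejectProb x) := by
  let K := (Submodule.span ℂ S)ᗮ
  obtain ⟨A, hA, hAx⟩ := exists_walkAverage_algorithm pos K s hs N hN
  refine ⟨A, hA, fun x => ⟨?_, ?_⟩⟩
  · rintro ⟨ψ, hort, hψs, hψn, hav⟩
    have hK : ψ ∈ K := by
      rw [Submodule.mem_orthogonal]
      intro u hu
      induction hu using Submodule.span_induction with
      | mem y hy => exact hort y hy
      | zero => simp
      | add a b _ _ ha hb => rw [inner_add_left, ha, hb, add_zero]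
      | smul c a _ ha => rw [inner_smul_left, ha, mul_zero]
    have hfix : walkStep pos K x ψ = ψ := by
      simp only [walkStep, LinearIsometryEquiv.trans_apply,
        Submodule.reflection_mem_subspace_eq_self hK]
      ext i
      rw [availReflection_apply]
      split_ifs with h
      · obtain ⟨a, ha, hx⟩ := h
        simp [hav i a ha hx]
      · rfl
    have hin := inner_walkAverage_of_fixed pos K x N hN (EuclideanSpace.single s 1) ψ hfix
    have h1 : inner ℂ ψ (EuclideanSpace.single s (1 : ℂ)) = 1 := by
      simp [EuclideanSpace.inner_single_right, hψs]
    rw [h1] at hin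
    have hcs := norm_inner_le_norm (𝕜 := ℂ) ψ (walkAverage pos K x N (EuclideanSpace.single s 1))
    rw [hin, norm_one] at hcs
    rw [(hAx x).1]
    have h2 : 1 ≤ ‖ψ‖ ^ 2 * ‖walkAverage pos K x N (EuclideanSpace.single s 1)‖ ^ 2 := by
      rw [← mul_pow]
      exact one_le_pow₀ hcs
    nlinarith [sq_nonneg ‖walkAverage pos K x N (EuclideanSpace.single s 1)‖]
  · rintro ⟨u, huS, hus, hun, hav⟩
    have hK : u ∈ Kᗮ := Submodule.le_orthogonal_orthogonal _ (Submodule.subset_span huS)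
    -- The first reflection negates `u`; the second undoes this at unavailable positions. The only
    -- nonzero available entry is at `s`, where `-1 = 1 - 2`.
    have hstep : walkStep pos K x u = u - (2 : ℂ) • EuclideanSpace.single s 1 := by
      simp only [walkStep, LinearIsometryEquiv.trans_apply,
        Submodule.reflection_mem_subspace_orthogonalComplement_eq_neg hK]
      ext i
      rw [availReflection_apply]
      by_cases hi : i = s
      · subst hi
        simp [hs, hus]
        norm_num
      · split_ifs with h
        · simp [hi]
        · have : u i = 0 := hav i hi fun a ha => by
            by_contra hx
            exact h ⟨a, ha, by simpa using hx⟩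
          simp [hi, this]
    have hle := norm_walkAverage_le pos K x N _ u hstep
    rw [(hAx x).2]
    have hN' : (0 : ℝ) < N := by exact_mod_cast hN
    have h2 : ‖walkAverage pos K x N (EuclideanSpace.single s 1)‖ ^ 2 ≤ 1 / 3 := by
      refine (pow_le_pow_left₀ (norm_nonneg _) hle 2).trans ?_
      rw [div_pow, div_le_iff₀ (by positivity)]
      linarith
    linarith

/-! ### Colourings of a graph by a subdivided star -/

section Minor

variable {d : ℕ} {l : Fin d → ℕ} {X : Type*}

/-- The distance from the root in the subdivided star. -/
def starLevel (l : Fin d → ℕ) : Option (Σ j : Fin d, Fin (l j)) → ℕ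
  | none => 0
  | some a => a.2.val + 1

theorem starLevel_of_legRel {p q : Option (Σ j : Fin d, Fin (l j))} (h : legRel l p q) :
    starLevel l q = starLevel l p + 1 := by
  rcases p with _ | a <;> rcases q with _ | b <;> simp_all [legRel, starLevel]

theorem legRel_some_right {p : Option (Σ j : Fin d, Fin (l j))} {j : Fin d} {i : Fin (l j)}
    (h : legRel l p (some ⟨j, i⟩)) : p = none ∨ ∃ i', p = some ⟨j, i'⟩ := by
  rcases p with _ | ⟨j', i'⟩
  · exact Or.inl rfl
  · obtain ⟨h1, _⟩ := h
    simp only at h1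
    subst h1
    exact Or.inr ⟨i', rfl⟩

/-- The edges of `G` that are coloured by the edges of the leg `j`. -/
def legGraph (G : SimpleGraph X) (c : X → Option (Σ j : Fin d, Fin (l j))) (j : Fin d) :
    SimpleGraph X where
  Adj a b := G.Adj a b ∧ ((∃ i, c b = some ⟨j, i⟩ ∧ legRel l (c a) (c b)) ∨
    ∃ i, c a = some ⟨j, i⟩ ∧ legRel l (c b) (c a))
  symm := ⟨fun _ _ h => ⟨h.1.symm, h.2.symm⟩⟩
  loopless := ⟨fun _ h => h.1.ne rfl⟩

/-- A vertex that is connected to a vertex of the colour of the leaf of the leg `j`, within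
that leg. -/
def ReachesLeaf (G : SimpleGraph X) (c : X → Option (Σ j : Fin d, Fin (l j))) (j : Fin d)
    (v : X) : Prop :=
  ∃ b i, c b = some ⟨j, i⟩ ∧ i.val + 1 = l j ∧ (legGraph G c j).Reachable v b

/-- The edges of all leg graphs whose components do not reach a leaf. -/
def unleafedGraph (G : SimpleGraph X) (c : X → Option (Σ j : Fin d, Fin (l j))) :
    SimpleGraph X where
  Adj a b := ∃ j, (legGraph G c j).Adj a b ∧ ¬ ReachesLeaf G c j a ∧ ¬ ReachesLeaf G c j b
  symm := ⟨fun _ _ ⟨j, h, ha, hb⟩ => ⟨j, h.symm, hb, ha⟩⟩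
  loopless := ⟨fun _ ⟨_, h, _⟩ => h.ne rfl⟩

variable {G : SimpleGraph X} {c : X → Option (Σ j : Fin d, Fin (l j))} {j : Fin d}

theorem legGraph_color_left {a b : X} (h : (legGraph G c j).Adj a b) :
    c a = none ∨ ∃ i, c a = some ⟨j, i⟩ := by
  rcases h.2 with ⟨i, hi, hr⟩ | ⟨i, hi, _⟩
  · rw [hi] at hr
    exact legRel_some_right hr
  · exact Or.inr ⟨i, hi⟩

theorem legGraph_starLevel_le {a b : X} (h : (legGraph G c j).Adj a b) :
    starLevel l (c b) ≤ starLevel l (c a) + 1 := by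
  rcases h.2 with ⟨_, _, hr⟩ | ⟨_, _, hr⟩
  · exact (starLevel_of_legRel hr).le
  · have := starLevel_of_legRel hr
    omega

theorem reachesLeaf_congr {a b : X} (h : (legGraph G c j).Reachable a b) :
    ReachesLeaf G c j a ↔ ReachesLeaf G c j b :=
  ⟨fun ⟨v, i, h1, h2, h3⟩ => ⟨v, i, h1, h2, h.symm.trans h3⟩,
    fun ⟨v, i, h1, h2, h3⟩ => ⟨v, i, h1, h2, h.trans h3⟩⟩

theorem unleafedGraph_le : unleafedGraph G c ≤ G := fun _ _ ⟨_, h, _⟩ => h.1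

/-- The vertex `v` differs from `u` in colour, so some edge of the unleafed graph leaves it; the
colour of `v` forces that edge to belong to the leg `j`. -/
theorem not_reachesLeaf_of_reachable {u v : X} (hu : c u = none)
    (h : (unleafedGraph G c).Reachable u v) {i : Fin (l j)} (hv : c v = some ⟨j, i⟩) :
    ¬ ReachesLeaf G c j v := by
  obtain ⟨p⟩ := h.symm
  cases p with
  | nil => simp [hu] at hv
  | cons hadj _ =>
    obtain ⟨j', h1, h2, _⟩ := hadj
    rcases legGraph_color_left h1 with h3 | ⟨i', h3⟩
    · simp [hv] at h3
    · rw [hv, Option.some.injEq, Sigma.mk.injEq] at h3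
      rw [h3.1]
      exact h2

/-- A path in `G`, in the colours of the leg `j` and the root, from `v` to a vertex of the colour of
the leaf. The vertices after the index `e` do not have the colour of the root. -/
theorem ReachesLeaf.exists_path {v : X} (hv : c v = none) (h : ReachesLeaf G c j v) :
    ∃ (g : ℕ → X) (e m : ℕ), g 0 = v ∧ (∀ t < m, G.Adj (g t) (g (t + 1))) ∧
      Set.InjOn g {t | t ≤ m} ∧ (∀ t ≤ m, c (g t) = none ∨ ∃ i, c (g t) = some ⟨j, i⟩) ∧
      (∀ t ≤ m, e < t → c (g t) ≠ none) ∧ e + l j ≤ m ∧ ∀ t ≤ m, ReachesLeaf G c j (g t) := by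
  classical
  obtain ⟨b, i, hb, hi, hr⟩ := h
  obtain ⟨p, hp⟩ := hr.exists_isPath
  have hadj : ∀ t < p.length, (legGraph G c j).Adj (p.getVert t) (p.getVert (t + 1)) :=
    fun t ht => p.adj_getVert_succ ht
  have hreach : ∀ t, (legGraph G c j).Reachable (p.getVert t) b := fun t => ⟨p.drop t⟩
  set e := Nat.findGreatest (fun t => c (p.getVert t) = none) p.length with he
  have hec : c (p.getVert e) = none := by
    have := Nat.findGreatest_spec (P := fun t => c (p.getVert t) = none) (Nat.zero_le p.length)
      (by simpa using hv)
    exact this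
  have hem : e ≤ p.length := Nat.findGreatest_le _
  -- The level is zero at the last root-coloured vertex and rises by at most one per edge, so the
  -- rest of the path is at least as long as the leg.
  have hlev : ∀ t, e + t ≤ p.length → starLevel l (c (p.getVert (e + t))) ≤ t := by
    intro t
    induction t with
    | zero => simp [hec, starLevel]
    | succ t ih =>
      intro ht
      have h1 := legGraph_starLevel_le (hadj (e + t) (by omega))
      have h2 := ih (by omega)
      rw [← add_assoc]
      omega
  refine ⟨p.getVert, e, p.length, by simp, fun t ht => (hadj t ht).1, hp.getVert_injOn, ?_, ?_, ?_,
    fun t _ => ⟨b, i, hb, hi, hreach t⟩⟩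
  · intro t ht
    rcases ht.lt_or_eq with ht | rfl
    · exact legGraph_color_left (hadj t ht)
    · rw [p.getVert_length]
      exact Or.inr ⟨i, hb⟩
  · intro t ht het
    exact Nat.findGreatest_is_greatest het ht
  · have h1 := hlev (p.length - e) (by omega)
    rw [show e + (p.length - e) = p.length by omega, p.getVert_length, hb] at h1
    simp only [starLevel] at h1
    omega

theorem connected_induce_image_Icc (g : ℕ → X) (a b : ℕ) (hab : a ≤ b)
    (h : ∀ t, a ≤ t → t < b → G.Adj (g t) (g (t + 1))) :
    (G.induce (g '' Set.Icc a b)).Connected := by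
  have hr : ∀ t (hat : a ≤ t) (htb : t ≤ b), (G.induce (g '' Set.Icc a b)).Reachable
      ⟨g a, a, ⟨le_rfl, hab⟩, rfl⟩ ⟨g t, t, ⟨hat, htb⟩, rfl⟩ := by
    intro t hat
    induction t, hat using Nat.le_induction with
    | base => intro _; rfl
    | succ t hat ih =>
      intro htb
      refine (ih (by omega)).trans (SimpleGraph.Adj.reachable ?_)
      exact h t hat (by omega)
  rw [SimpleGraph.connected_iff_exists_forall_reachable]
  refine ⟨⟨g a, a, ⟨le_rfl, hab⟩, rfl⟩, ?_⟩
  rintro ⟨_, t, ⟨hat, htb⟩, rfl⟩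
  exact hr t hat htb

theorem connected_induce_reachable {Q : SimpleGraph X} (hQ : Q ≤ G) (u : X) :
    (G.induce {v | Q.Reachable u v}).Connected := by
  have h := (Q.connectedComponentMk u).connected_toSimpleGraph
  have hs : {v | Q.Reachable u v} = (Q.connectedComponentMk u).supp := by
    ext v
    simp [SimpleGraph.ConnectedComponent.mem_supp_iff, SimpleGraph.ConnectedComponent.eq,
      SimpleGraph.reachable_comm]
  rw [hs]
  exact h.mono fun a b hab => hQ hab

/-- The root's branch set is the component of `u` together with the paths up to their last
root-coloured vertex; the tails of the paths form the legs. Tails of different legs differ in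
colour, and a tail avoids the component because its vertices reach the leaf of their own leg. -/
theorem isGraphMinor_of_reachesLeaf (hl : ∀ j, 0 < l j) {u : X} (hu : c u = none)
    (h : ∀ j, ∃ v, c v = none ∧ (unleafedGraph G c).Reachable u v ∧ ReachesLeaf G c j v) :
    IsGraphMinor (subdividedStar l) G := by
  choose v hvc hvr hvl using h
  have hp := fun j => (hvl j).exists_path (hvc j)
  choose g e m h0 hadj hinj hcol hnone hem hleaf using hp
  have hleg : ∀ j t, e j < t → t ≤ m j → ∃ i, c (g j t) = some ⟨j, i⟩ := fun j t h1 h2 =>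
    (hcol j t h2).resolve_left (hnone j t h2 h1)
  -- Each vertex of a leg receives one vertex of the tail, except the leaf, which absorbs all that
  -- remains.
  let top : (Σ j : Fin d, Fin (l j)) → ℕ := fun a =>
    if a.2.val + 1 < l a.1 then e a.1 + 1 + a.2.val else m a.1
  have htop : ∀ a, e a.1 + 1 + a.2.val ≤ top a ∧ top a ≤ m a.1 := by
    intro a
    have h1 := hem a.1
    have h2 := a.2.isLt
    simp only [top]
    split_ifs <;> omega
  let R : Set X := {v | (unleafedGraph G c).Reachable u v}
  let B : Option (Σ j : Fin d, Fin (l j)) → Set X := fun o =>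
    match o with
    | none => R ∪ ⋃ j, g j '' Set.Icc 0 (e j)
    | some a => g a.1 '' Set.Icc (e a.1 + 1 + a.2.val) (top a)
  have hroot : ∀ a, Disjoint (B none) (B (some a)) := by
    intro a
    rw [Set.disjoint_left]
    rintro x hx ⟨t, ⟨ht1, ht2⟩, rfl⟩
    have ht3 := ht2.trans (htop a).2
    obtain ⟨i, hi⟩ := hleg a.1 t (by omega) ht3
    rcases hx with hx | hx
    · exact not_reachesLeaf_of_reachable hu hx hi (hleaf a.1 t ht3)
    · obtain ⟨j, t', ⟨-, ht'⟩, heq⟩ := Set.mem_iUnion.mp hx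
      have hl' := hl j
      have hm := hem j
      by_cases hj : j = a.1
      · subst hj
        have := hinj a.1 (show t' ≤ m a.1 by omega) ht3 heq
        omega
      · rcases hcol j t' (by omega) with h1 | ⟨i', h1⟩
        · rw [heq, hi] at h1
          simp at h1
        · rw [heq, hi, Option.some.injEq, Sigma.mk.injEq] at h1
          exact hj h1.1.symm
  have hlegs : ∀ a b, a ≠ b → Disjoint (B (some a)) (B (some b)) := by
    rintro ⟨j, i⟩ ⟨j', i'⟩ hab
    rw [Set.disjoint_left]
    rintro x ⟨t, ⟨ht1, ht2⟩, rfl⟩ ⟨t', ⟨ht1', ht2'⟩, heq⟩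
    have ht3 := ht2.trans (htop ⟨j, i⟩).2
    have ht3' := ht2'.trans (htop ⟨j', i'⟩).2
    simp only at ht1 ht1' ht3 ht3' heq
    obtain ⟨k, hk⟩ := hleg j t (by omega) ht3
    obtain ⟨k', hk'⟩ := hleg j' t' (by omega) ht3'
    rw [heq, hk, Option.some.injEq, Sigma.mk.injEq] at hk'
    obtain rfl := hk'.1
    have htt := hinj j ht3' ht3 heq
    have hne : i.val ≠ i'.val := fun hv => hab (by rw [Fin.ext hv])
    have hi := i.isLt
    have hi' := i'.isLt
    simp only [top] at ht2 ht2'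
    split_ifs at ht2 ht2' <;> omega
  have hedge : ∀ p q, legRel l p q → ∃ x ∈ B p, ∃ y ∈ B q, G.Adj x y := by
    rintro (_ | ⟨j, i⟩) (_ | ⟨j', i'⟩) hr
    · exact hr.elim
    · have hi' : i'.val = 0 := hr
      have h1 := htop ⟨j', i'⟩
      simp only [hi'] at h1
      refine ⟨g j' (e j'), Or.inr (Set.mem_iUnion.mpr ⟨j', e j', ⟨Nat.zero_le _, le_rfl⟩, rfl⟩),
        g j' (e j' + 1), ⟨e j' + 1, ⟨?_, ?_⟩, rfl⟩, hadj j' _ ?_⟩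
      · simp [hi']
      · exact h1.1
      · exact h1.1.trans h1.2
    · exact hr.elim
    · obtain ⟨h1, h2⟩ := hr
      simp only at h1 h2
      subst h1
      have hlt := i'.isLt
      have hm := hem j
      have ht : top ⟨j, i⟩ = e j + 1 + i.val := by
        simp only [top]
        rw [if_pos (by omega)]
      refine ⟨g j (e j + 1 + i.val), ⟨_, ⟨le_rfl, (htop ⟨j, i⟩).1⟩, rfl⟩,
        g j (e j + 1 + i.val + 1), ⟨_, ⟨?_, ?_⟩, rfl⟩, hadj j _ ?_⟩
      · simp only
        omega
      · have := (htop ⟨j, i'⟩).1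
        simp only at this
        omega
      · omega
  refine ⟨B, ?_, ?_, ?_⟩
  · rintro (_ | a)
    · have huR : u ∈ R := SimpleGraph.Reachable.refl u
      have hconn : ∀ j, (G.induce (R ∪ g j '' Set.Icc 0 (e j))).Connected := by
        intro j
        refine SimpleGraph.induce_union_connected
          (connected_induce_reachable unleafedGraph_le u).preconnected
          (connected_induce_image_Icc _ _ _ (Nat.zero_le _) fun t _ ht =>
            hadj j t (by have := hem j; omega)).preconnected ⟨v j, hvr j, 0, ⟨le_rfl, Nat.zero_le _⟩,
            h0 j⟩
      refine SimpleGraph.induce_connected_of_patches u (Or.inl huR) fun {x} hx => ?_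
      rcases hx with hx | hx
      · exact ⟨R, Set.subset_union_left, huR, hx,
          (connected_induce_reachable unleafedGraph_le u).preconnected _ _⟩
      · obtain ⟨j, hj⟩ := Set.mem_iUnion.mp hx
        exact ⟨R ∪ g j '' Set.Icc 0 (e j),
          Set.union_subset_union_right _ (Set.subset_iUnion (fun j => g j '' Set.Icc 0 (e j)) j),
          Or.inl huR, Or.inr hj, (hconn j).preconnected _ _⟩
    · exact connected_induce_image_Icc _ _ _ (htop a).1 fun t _ ht =>
        hadj a.1 t (ht.trans_le (htop a).2)
  · rintro (_ | a) (_ | b) hne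
    · exact absurd rfl hne
    · exact hroot b
    · exact (hroot a).symm
    · exact hlegs a b fun hab => hne (by rw [hab])
  · intro p q hpq
    rw [subdividedStar, SimpleGraph.fromRel_adj] at hpq
    rcases hpq.2 with hr | hr
    · exact hedge p q hr
    · obtain ⟨x, hx, y, hy, hxy⟩ := hedge q p hr
      exact ⟨y, hy, x, hx, hxy.symm⟩

/-- The cut that certifies the absence of the minor: a choice of one leg at every vertex of the
colour of the root, constant along the edges of each leg, that never reaches a leaf. -/
theorem exists_leg_choice (hl : ∀ j, 0 < l j) (hG : ¬ IsGraphMinor (subdividedStar l) G) :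
    ∃ w : Fin d → X → Prop,
      (∀ j b i, c b = some ⟨j, i⟩ → i.val + 1 = l j → ¬ w j b) ∧
      (∀ u, c u = none → ∃! j, w j u) ∧
      ∀ a b j i, G.Adj a b → legRel l (c a) (c b) → c b = some ⟨j, i⟩ → (w j a ↔ w j b) := by
  classical
  let Q := unleafedGraph G c
  -- The legs whose leaf is reached, within the leg, from no root-coloured vertex of the component.
  -- Without the minor, each component with a root-coloured vertex has such a leg.
  let P : Q.ConnectedComponent → Fin d → Prop := fun C j =>
    ∀ v, c v = none → Q.connectedComponentMk v = C → ¬ ReachesLeaf G c j v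
  -- The selected leg depends only on the component. An edge of the leg `j` either lies in a part
  -- that reaches the leaf, where the predicate fails at both ends, or joins vertices of the same
  -- component.
  refine ⟨fun j v => ¬ ReachesLeaf G c j v ∧
    ∃ h : ∃ j, P (Q.connectedComponentMk v) j, h.choose = j, ?_, ?_, ?_⟩
  · intro j b i hb hi hw
    exact hw.1 ⟨b, i, hb, hi, SimpleGraph.Reachable.refl b⟩
  · intro u hu
    have hP : ∃ j, P (Q.connectedComponentMk u) j := by
      by_contra hcon
      simp only [P, not_exists, not_forall, not_not] at hcon
      refine hG (isGraphMinor_of_reachesLeaf hl hu fun j => ?_)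
      obtain ⟨v, hv, hvu, hvl⟩ := hcon j
      exact ⟨v, hv, (SimpleGraph.ConnectedComponent.exact hvu).symm, hvl⟩
    exact ⟨hP.choose, ⟨hP.choose_spec u hu rfl, hP, rfl⟩, fun j ⟨_, _, hj⟩ => hj.symm⟩
  · intro a b j i hab hr hb
    have hadj : (legGraph G c j).Adj a b := ⟨hab, Or.inl ⟨i, hb, hr⟩⟩
    have hiff := reachesLeaf_congr hadj.reachable
    by_cases hleaf : ReachesLeaf G c j b
    · simp [hiff, hleaf]
    · have hQ : Q.connectedComponentMk a = Q.connectedComponentMk b :=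
        SimpleGraph.ConnectedComponent.sound
          (SimpleGraph.Adj.reachable ⟨j, hadj, fun h => hleaf (hiff.mp h), hleaf⟩)
      simp only [hiff, hQ]

end Minor

/-! ### The span program for a subdivided star -/

section StarProgram

variable {d : ℕ} {l : Fin d → ℕ} {n : ℕ}

/-- The colours: the vertices of the subdivided star. -/
abbrev StarVertex {d : ℕ} (l : Fin d → ℕ) : Type := Option (Σ j : Fin d, Fin (l j))

/-- The positions of the span program: a special one, and one for each pair of vertices under each
colouring. -/
abbrev StarPosition {d : ℕ} (l : Fin d → ℕ) (n : ℕ) : Type :=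
  Option ((Fin n → StarVertex l) × (Fin n × Fin n))

open Classical in
/-- The difference of the potential `w` along a pair that is coloured by an edge of the star,
directed away from the root. -/
noncomputable def potentialDrop (c : Fin n → StarVertex l) (w : Fin d → Fin n → ℂ) (a b : Fin n) : ℂ :=
  match c b with
  | none => 0
  | some v => if legRel l (c a) (some v) then w v.1 a - w v.1 b else 0

/-- The vector of the differences of a family of potentials, with the entry `σ * s` at the
special position. -/
noncomputable def dropVector (σ s : ℂ) (w : (Fin n → StarVertex l) → Fin d → Fin n → ℂ) :
    EuclideanSpace ℂ (StarPosition l n) :=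
  WithLp.toLp 2 fun
    | none => σ * s
    | some (c, a, b) => potentialDrop c (w c) a b

/-- Potentials that vanish at the leaves and whose values at a root, one for each leg, add
up to `s`. -/
def dropVectors (l : Fin d → ℕ) (n : ℕ) (σ : ℂ) : Set (EuclideanSpace ℂ (StarPosition l n)) :=
  {y | ∃ (s : ℂ) (w : (Fin n → StarVertex l) → Fin d → Fin n → ℂ),
    (∀ c j b i, c b = some ⟨j, i⟩ → i.val + 1 = l j → w c j b = 0) ∧
    (∀ c u, c u = none → ∑ j, w c j u = s) ∧ y = dropVector σ s w}

/-- The vertex at distance `t` from the root on the leg `j`. -/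
def legVertex (l : Fin d → ℕ) (j : Fin d) : ℕ → StarVertex l
  | 0 => none
  | t + 1 => if h : t < l j then some ⟨j, t, h⟩ else none

theorem legRel_legVertex (v : Σ j : Fin d, Fin (l j)) :
    legRel l (legVertex l v.1 v.2.val) (some v) := by
  obtain ⟨j, t, ht⟩ := v
  cases t with
  | zero => rfl
  | succ t =>
    have : t < l j := by omega
    simp [legVertex, this, legRel]

theorem legVertex_succ (v : Σ j : Fin d, Fin (l j)) :
    legVertex l v.1 (v.2.val + 1) = some v := by
  simp [legVertex]

/-- Along each leg the differences telescope from the root to the leaf, where the potential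
vanishes. -/
theorem sum_drop_eq (hl : ∀ j, 0 < l j) (φ : Fin d → StarVertex l → ℂ)
    (hφ : ∀ j i, i.val + 1 = l j → φ j (some ⟨j, i⟩) = 0) :
    ∑ v : Σ j : Fin d, Fin (l j), (φ v.1 (legVertex l v.1 v.2.val) - φ v.1 (some v)) =
      ∑ j, φ j none := by
  rw [Fintype.sum_sigma]
  refine Finset.sum_congr rfl fun j _ => ?_
  have h : ∀ i : Fin (l j), φ j (legVertex l j i.val) - φ j (some ⟨j, i⟩) =
      φ j (legVertex l j i.val) - φ j (legVertex l j (i.val + 1)) := fun i => by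
    rw [legVertex_succ ⟨j, i⟩]
  simp only [h]
  rw [Fin.sum_univ_eq_sum_range (fun t => φ j (legVertex l j t) - φ j (legVertex l j (t + 1))),
    Finset.sum_range_sub']
  have hlt : l j - 1 < l j := Nat.sub_lt (hl j) one_pos
  have hend : legVertex l j (l j) = some ⟨j, l j - 1, hlt⟩ := by
    have := legVertex_succ (l := l) ⟨j, l j - 1, hlt⟩
    rwa [Nat.sub_add_cancel (hl j)] at this
  rw [hend, hφ j _ (Nat.sub_add_cancel (hl j)), sub_zero]
  rfl

/-- The colourings that restrict to the identity on a copy of the star. -/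
abbrev GoodColouring (f : StarVertex l → Fin n) : Type := {c : Fin n → StarVertex l // ∀ v, c (f v) = v}

/-- A colouring is recovered from its restriction to the copy and the good colouring obtained by
overwriting it there. -/
theorem card_colourings_le (f : StarVertex l → Fin n) (hf : Function.Injective f) :
    Fintype.card (StarVertex l) ^ n ≤
      Fintype.card (GoodColouring f) * Fintype.card (StarVertex l) ^ Fintype.card (StarVertex l) := by
  classical
  let F : (Fin n → StarVertex l) → GoodColouring f × (StarVertex l → StarVertex l) := fun c =>
    (⟨Function.extend f id c, fun v => hf.extend_apply _ _ v⟩, c ∘ f)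
  have hF : Function.Injective F := by
    intro c c' h
    simp only [F, Prod.mk.injEq, Subtype.mk.injEq] at h
    funext a
    by_cases ha : ∃ v, f v = a
    · obtain ⟨v, rfl⟩ := ha
      exact congrFun h.2 v
    · have := congrFun h.1 a
      rwa [Function.extend_apply' _ _ _ ha, Function.extend_apply' _ _ _ ha] at this
  have := Fintype.card_le_of_injective F hF
  simpa using this

/-- The positions of the edges of a copy of the star, under the colourings that are good for it. -/
def copyEdge (f : StarVertex l → Fin n) (hf : Function.Injective f) :
    GoodColouring f × (Σ j : Fin d, Fin (l j)) ↪ (Fin n → StarVertex l) × (Fin n × Fin n) where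
  toFun p := (p.1.val, f (legVertex l p.2.1 p.2.2.val), f (some p.2))
  inj' p q h := by
    simp only [Prod.mk.injEq] at h
    exact Prod.ext (Subtype.ext h.1) (Option.some_injective _ (hf h.2.2))

open Classical in
/-- A flow through the edges of a copy of the star, under all good colourings. -/
noncomputable def copyFlow (f : StarVertex l → Fin n) (hf : Function.Injective f) (θ : ℝ) :
    EuclideanSpace ℂ (StarPosition l n) :=
  WithLp.toLp 2 fun
    | none => 1
    | some q => if q ∈ Finset.univ.map (copyEdge f hf) then -(θ : ℂ) else 0

theorem norm_copyFlow_sq (f : StarVertex l → Fin n) (hf : Function.Injective f) (θ : ℝ) :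
    ‖copyFlow f hf θ‖ ^ 2 = 1 + Fintype.card (GoodColouring f) *
      Fintype.card (Σ j : Fin d, Fin (l j)) * θ ^ 2 := by
  classical
  rw [EuclideanSpace.norm_sq_eq, Fintype.sum_option]
  have h : ∀ q, ‖copyFlow f hf θ (some q)‖ ^ 2 =
      if q ∈ Finset.univ.map (copyEdge f hf) then θ ^ 2 else 0 := by
    intro q
    simp only [copyFlow]
    split_ifs <;> simp
  have h0 : copyFlow f hf θ none = 1 := rfl
  simp only [h, h0]
  rw [Finset.sum_ite_mem, Finset.univ_inter, Finset.sum_const, Finset.card_map, Finset.card_univ,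
    Fintype.card_prod]
  simp

/-- Each good colouring contributes `-θ * s` by telescoping along the legs, and `hθ` makes the total
cancel the special entry `σ * s`. -/
theorem inner_copyFlow_eq_zero (hl : ∀ j, 0 < l j) (f : StarVertex l → Fin n)
    (hf : Function.Injective f) (σ θ : ℝ) (hθ : Fintype.card (GoodColouring f) * θ = σ)
    (y : EuclideanSpace ℂ (StarPosition l n)) (hy : y ∈ dropVectors l n σ) :
    inner ℂ y (copyFlow f hf θ) = 0 := by
  classical
  obtain ⟨s, w, hleaf, hroot, rfl⟩ := hy
  -- With the real flow as first argument, no conjugates of the potentials appear.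
  rw [← inner_conj_symm, map_eq_zero, PiLp.inner_apply, Fintype.sum_option]
  have h : ∀ q, inner ℂ (copyFlow f hf θ (some q)) (dropVector (σ : ℂ) s w (some q)) =
      if q ∈ Finset.univ.map (copyEdge f hf) then -(θ : ℂ) * dropVector (σ : ℂ) s w (some q)
        else 0 := by
    intro q
    simp only [copyFlow]
    split_ifs
    · simp [mul_comm]
    · simp
  have h0 : inner ℂ (copyFlow f hf θ none) (dropVector (σ : ℂ) s w none) = σ * s := by
    simp [copyFlow, dropVector]
  have hdrop : ∀ p, dropVector (σ : ℂ) s w (some (copyEdge f hf p)) =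
      w p.1.val p.2.1 (f (legVertex l p.2.1 p.2.2.val)) - w p.1.val p.2.1 (f (some p.2)) := by
    rintro ⟨⟨c, hc⟩, v⟩
    change potentialDrop c (w c) (f (legVertex l v.1 v.2.val)) (f (some v)) = _
    unfold potentialDrop
    rw [hc (some v)]
    simp [hc, legRel_legVertex]
  simp only [h, h0]
  rw [Finset.sum_ite_mem, Finset.univ_inter, Finset.sum_map, ← Finset.mul_sum]
  simp only [hdrop]
  rw [Fintype.sum_prod_type]
  have hc : ∀ c : GoodColouring f, ∑ v : Σ j : Fin d, Fin (l j),
      (w c.val v.1 (f (legVertex l v.1 v.2.val)) - w c.val v.1 (f (some v))) = s := by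
    intro c
    rw [sum_drop_eq hl (fun j p => w c.val j (f p))]
    · exact hroot c.val (f none) (c.2 none)
    · intro j i hi
      exact hleaf c.val j _ i (c.2 _) hi
  simp only [hc]
  rw [Finset.sum_const, Finset.card_univ, nsmul_eq_mul, ← hθ]
  push_cast
  ring

/-- Without the minor some vector of potential differences is small, and vanishes at
the edges of the graph. -/
theorem exists_dropVector_of_not_minor (hl : ∀ j, 0 < l j) (G : SimpleGraph (Fin n))
    (hG : ¬ IsGraphMinor (subdividedStar l) G) (σ : ℝ) (hσ : σ ≠ 0) :
    ∃ y ∈ dropVectors l n σ, y none = 1 ∧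
      ‖y‖ ^ 2 ≤ 1 + Fintype.card (StarVertex l) ^ n * n ^ 2 / σ ^ 2 ∧
      ∀ c a b, G.Adj a b → y (some (c, a, b)) = 0 := by
  classical
  choose W hleaf hroot hedge using fun c : Fin n → StarVertex l => exists_leg_choice (c := c) hl hG
  -- The scale `σ⁻¹` is the common sum at roots, so the special entry becomes `1`.
  let w : (Fin n → StarVertex l) → Fin d → Fin n → ℂ := fun c j v =>
    if W c j v then (σ : ℂ)⁻¹ else 0
  have hσ' : (σ : ℂ) ≠ 0 := by exact_mod_cast hσ
  have hdrop : ∀ c a b, ‖potentialDrop c (w c) a b‖ ^ 2 ≤ (σ ^ 2)⁻¹ := by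
    intro c a b
    have hpos : (0 : ℝ) ≤ (σ ^ 2)⁻¹ := by positivity
    unfold potentialDrop
    split
    · simpa using hpos
    · simp only [w]
      split_ifs <;> simp [hpos]
  refine ⟨dropVector σ (σ : ℂ)⁻¹ w, ⟨_, w, ?_, ?_, rfl⟩, ?_, ?_, ?_⟩
  · intro c j b i hb hi
    simp [w, hleaf c j b i hb hi]
  · intro c u hu
    obtain ⟨j, hj, huniq⟩ := hroot c u hu
    rw [Finset.sum_eq_single j]
    · simp [w, hj]
    · intro j' _ hne
      have : ¬ W c j' u := fun h => hne (huniq j' h)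
      simp [w, this]
    · simp
  · simp [dropVector, hσ']
  · rw [EuclideanSpace.norm_sq_eq, Fintype.sum_option]
    have h0 : dropVector (σ : ℂ) (σ : ℂ)⁻¹ w none = 1 := by simp [dropVector, hσ']
    rw [h0]
    have hsum : ∑ q, ‖dropVector (σ : ℂ) (σ : ℂ)⁻¹ w (some q)‖ ^ 2 ≤
        ∑ _q : (Fin n → StarVertex l) × (Fin n × Fin n), (σ ^ 2)⁻¹ :=
      Finset.sum_le_sum fun q _ => hdrop q.1 q.2.1 q.2.2
    rw [Finset.sum_const, Finset.card_univ, nsmul_eq_mul] at hsum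
    have hcard : (Fintype.card ((Fin n → StarVertex l) × (Fin n × Fin n)) : ℝ) =
        Fintype.card (StarVertex l) ^ n * n ^ 2 := by
      rw [Fintype.card_prod, Fintype.card_prod, Fintype.card_fun, Fintype.card_fin]
      push_cast
      ring
    rw [hcard, ← div_eq_mul_inv] at hsum
    simpa using hsum
  · intro c a b hab
    simp only [dropVector, potentialDrop]
    split
    · rfl
    · rename_i v hv
      split_ifs with hr
      · rw [← hv] at hr
        have := hedge c a b v.1 v.2 hab hr hv
        simp [w, this]
      · rfl

theorem exists_star_algorithm (hl : ∀ j, 0 < l j) (hn : 0 < n) :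
    ∃ A : QueryAlgorithm (Fin n × Fin n),
      A.queries = (3 + 6 * Fintype.card (StarVertex l) ^ (Fintype.card (StarVertex l) + 1)) * n ∧
      ∀ G : SimpleGraph (Fin n),
        ((subdividedStar l).IsContained G → 2 / 3 ≤ A.acceptProb (adjInput G)) ∧
        (¬ IsGraphMinor (subdividedStar l) G → 2 / 3 ≤ A.rejectProb (adjInput G)) := by
  classical
  set k := Fintype.card (StarVertex l) with hk
  have hk1 : 0 < k := Fintype.card_pos
  have hkR : (0 : ℝ) < k := by exact_mod_cast hk1
  -- This balances the two witnesses: the flow costs at most `k * σ ^ 2 / k ^ (n - k) = 1 / 2`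
  -- beyond its special entry when `n ≥ k`, and the cut costs at most `k ^ n * n ^ 2 / σ ^ 2 = 2 * k
  -- ^ (k + 1) * n ^ 2`.
  set σ : ℝ := √(k ^ n / (2 * k ^ (k + 1))) with hσ
  have hσ2 : σ ^ 2 = k ^ n / (2 * k ^ (k + 1)) := Real.sq_sqrt (by positivity)
  have hσ0 : 0 < σ := Real.sqrt_pos.mpr (by positivity)
  obtain ⟨A, hA, hAx⟩ := exists_queryAlgorithm_of_tests
    (fun i : StarPosition l n => i.map Prod.snd) none rfl (dropVectors l n σ)
    ((3 + 6 * k ^ (k + 1)) * n) (by positivity)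
  refine ⟨A, hA, fun G => ⟨fun ⟨φ⟩ => (hAx _).1 ?_, fun hG => (hAx _).2 ?_⟩⟩
  · have hf : Function.Injective φ := φ.injective
    have hle : (k : ℝ) ^ n ≤ Fintype.card (GoodColouring φ) * k ^ k := by
      exact_mod_cast card_colourings_le φ hf
    set g : ℝ := ((Fintype.card (GoodColouring φ) : ℕ) : ℝ) with hg
    have hg0 : 0 < g := by
      by_contra hneg
      have h1 : (0 : ℝ) < k ^ n := by positivity
      have h2 : (0 : ℝ) < k ^ k := by positivity
      nlinarith
    refine ⟨copyFlow φ hf (σ / g), fun y hy =>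
      inner_copyFlow_eq_zero hl φ hf σ (σ / g) (by change g * (σ / g) = σ; field_simp) y hy, rfl, ?_, ?_⟩
    · rw [norm_copyFlow_sq, div_pow, hσ2]
      set m : ℝ := ((Fintype.card (Σ j : Fin d, Fin (l j)) : ℕ) : ℝ) with hm
      have hmk : m ≤ k := by
        have : k = Fintype.card (Σ j : Fin d, Fin (l j)) + 1 := Fintype.card_option
        rw [hm, this]
        push_cast
        linarith
      have hm0 : 0 ≤ m := by positivity
      have key : g * m * (k ^ n / (2 * k ^ (k + 1)) / g ^ 2) ≤ 1 / 2 := by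
        have heq : g * m * (k ^ n / (2 * k ^ (k + 1)) / g ^ 2) =
            (m * k ^ n) / (2 * (k * (g * k ^ k))) := by
          field_simp
          ring
        rw [heq, div_le_div_iff₀ (by positivity) (by norm_num)]
        have := mul_le_mul hmk hle (by positivity) hkR.le
        linarith
      linarith
    · rintro (_ | q) p hp hx
      · simp at hp
      · simp only [Option.map_some, Option.some.injEq] at hp
        simp only [copyFlow]
        rw [if_neg]
        rw [Finset.mem_map]
        rintro ⟨⟨c, v⟩, -, rfl⟩
        subst hp
        have hrel := legRel_legVertex v
        have hadj : (subdividedStar l).Adj (legVertex l v.1 v.2.val) (some v) := by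
          rw [subdividedStar, SimpleGraph.fromRel_adj]
          refine ⟨fun h => ?_, Or.inl hrel⟩
          have := starLevel_of_legRel hrel
          rw [h] at this
          omega
        have hG : G.Adj (φ (legVertex l v.1 v.2.val)) (φ (some v)) := φ.toHom.map_adj hadj
        change decide (G.Adj (φ (legVertex l v.1 v.2.val)) (φ (some v))) = false at hx
        simp [hG] at hx
  · obtain ⟨y, hy, hy1, hyn, hy0⟩ := exists_dropVector_of_not_minor hl G hG σ hσ0.ne'
    refine ⟨y, hy, hy1, ?_, ?_⟩
    -- With `c = k ^ (k + 1)`, the query count must satisfy `3 * (1 + 2 * c * n ^ 2) ≤ ((3 + 6 * c)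
    -- * n) ^ 2`.
    · have hb : (k : ℝ) ^ n * n ^ 2 / σ ^ 2 = 2 * k ^ (k + 1) * n ^ 2 := by
        rw [hσ2]
        field_simp
      rw [← hk, hb] at hyn
      have hn1 : (1 : ℝ) ≤ n ^ 2 := by exact_mod_cast Nat.one_le_pow _ _ hn
      set c : ℝ := (k : ℝ) ^ (k + 1) with hc
      have hc0 : 0 ≤ c := by positivity
      push_cast
      rw [← hc, mul_pow]
      nlinarith [mul_nonneg hc0 (sub_nonneg.mpr hn1), mul_nonneg hc0 hc0,
        mul_nonneg (mul_nonneg hc0 hc0) (sub_nonneg.mpr hn1)]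
    · rintro (_ | ⟨c, a, b⟩) hi hx
      · exact absurd rfl hi
      · refine hy0 c a b ?_
        simpa [adjInput] using hx (a, b) rfl

end StarProgram

/-- An algorithm without queries that always rejects. -/
theorem exists_rejecting_algorithm (ι : Type) [Fintype ι] [DecidableEq ι] :
    ∃ A : QueryAlgorithm ι, A.queries = 0 ∧ ∀ x, A.rejectProb x = 1 := by
  let start : QueryBasis ι Unit := (none, false, ())
  refine ⟨{ work := Unit, start := start, queries := 0, U := fun _ => 1, output := fun _ => false },
    rfl, fun x => ?_⟩
  simp only [QueryAlgorithm.rejectProb, QueryAlgorithm.outputProb, QueryAlgorithm.state]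
  rw [Finset.filter_true_of_mem (by simp), Finset.sum_eq_single start]
  · simp
  · intro p _ hp
    simp [hp]
  · simp

theorem IsGraphMinor.of_iso {V V' W : Type*} {T : SimpleGraph V} {T' : SimpleGraph V'}
    {G : SimpleGraph W} (φ : T ≃g T') (h : IsGraphMinor T' G) : IsGraphMinor T G := by
  obtain ⟨B, h1, h2, h3⟩ := h
  exact ⟨fun v => B (φ v), fun v => h1 _, fun u v huv => h2 _ _ (φ.injective.ne huv),
    fun u v huv => h3 _ _ (φ.map_adj_iff.mpr huv)⟩

theorem theorem4p2 {V : Type*} (T : SimpleGraph V) (hT : IsSubdividedStar T) :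
    ∃ C : ℕ, ∀ n : ℕ, ∃ A : QueryAlgorithm (Fin n × Fin n),
      A.queries ≤ C * n ∧
      ∀ G : SimpleGraph (Fin n),
        (T.IsContained G → 2 / 3 ≤ A.acceptProb (adjInput G)) ∧
        (¬ IsGraphMinor T G → 2 / 3 ≤ A.rejectProb (adjInput G)) := by
  obtain ⟨d, l, hl, ⟨φ⟩⟩ := hT
  refine ⟨3 + 6 * Fintype.card (StarVertex l) ^ (Fintype.card (StarVertex l) + 1), fun n => ?_⟩
  -- For `n = 0` no query is allowed; the star has a root, so it is not contained in the empty graph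
  -- and rejecting is correct.
  rcases Nat.eq_zero_or_pos n with rfl | hn
  · obtain ⟨A, hA, hrej⟩ := exists_rejecting_algorithm (Fin 0 × Fin 0)
    refine ⟨A, by simp [hA], fun G => ⟨fun ⟨f⟩ => (f (φ.symm none)).elim0, fun _ => ?_⟩⟩
    rw [hrej]
    norm_num
  · obtain ⟨A, hA, hG⟩ := exists_star_algorithm hl hn
    refine ⟨A, hA.le, fun G => ⟨fun h => (hG G).1 ?_, fun h => (hG G).2 fun h' => h (h'.of_iso φ)⟩⟩
    exact SimpleGraph.IsContained.trans ⟨φ.symm.toCopy⟩ h
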